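/- Let $0<a<b$ and let $d:\mathbb R\to[0,\infty)$ be a probability density ($\int_{\mathbb R} d=1$) which vanishes outside $[a,b]$, is continuous on $[a,b]$ and twice continuously differentiable on $(a,b)$, and satisfies $d(a)d(b)\neq 0$. For $n\ge 1$ let $d^{*n}$ be the $n$-fold convolution of $d$ with itself. For each $x>0$ only finitely many of the values $d^{*n}(x)$ are nonzero; put $$F_d(x):=\sum_{n=1}^\infty \frac{d^{*n}(x)}{n}\quad(x>0),\qquad \widehat d(k):=\int_a^b d(x)e^{ikx}\,dx,\qquad f(k):=\widehat d(k)-1\quad(k\in\mathbb C).$$ For every $c>0$, the function $f$ has only finitely many zeros in the strip $\Pi_c:=\{k\in\mathbb C:-c<\operatorname{Im}k<0\}$. Suppose moreover that $f$ does not vanish on the line $\{k\in\mathbb C:\operatorname{Im}k=-c\}$, and put $$f_c(u):=\frac{\widehat d\,'(u-ic)}{1-\widehat d(u-ic)}-\widehat d\,'(u-ic)\quad(u\in\mathbb R),\qquad E(c,x):=\frac1{2\pi i}\int_{\mathbb R} f_c(u)\,e^{-iux}\,du .$$ Then $f_c\in L^1(\mathbb R)$, and $|E(c,x)|\le\frac1{2\pi}\|f_c\|_{L^1(\mathbb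 R)}$ for all $x>0$. Furthermore, for every $x>0$ with $x\notin[a,b]$ (in particular for every $x>b$), $$F_d(x)=\frac1x\Big(1+\sum_{k} m(k)e^{-ikx}+E(c,x)e^{-cx}\Big),$$ where the sum runs over the zeros $k$ of $f$ in $\Pi_c$ and $m(k)$ is the multiplicity of the zero $k$. More generally, for every $x>0$, $$F_d(x)=d(x)+\frac1x\Big(1+\sum_{k} m(k)e^{-ikx}+E(c,x)e^{-cx}\Big).$$ -/

import Mathlib

open MeasureTheory

noncomputable section

/-- `convPow d n` is the `n`-fold convolution `d * ⋯ * d` with respect to Lebesgue measure,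
for `n ≥ 1`. The value at `n = 0` is never used. -/
def convPow (d : ℝ → ℝ) : ℕ → ℝ → ℝ
  | 0 => 0
  | 1 => d
  | n + 2 => convolution d (convPow d (n + 1)) (ContinuousLinearMap.mul ℝ ℝ) volume

/-- The series `F_d(x) = ∑_{n ≥ 1} d^{*n}(x) / n`. -/
def convSeries (d : ℝ → ℝ) (x : ℝ) : ℝ :=
  ∑' n : ℕ, convPow d (n + 1) x / ((n : ℝ) + 1)

/-- The Fourier transform `∫_a^b d(x) e^{ikx} dx` at a complex argument `k`. -/
def fourierHat (a b : ℝ) (d : ℝ → ℝ) (k : ℂ) : ℂ :=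
  ∫ x in a..b, (d x : ℂ) * Complex.exp (Complex.I * k * (x : ℂ))

/-- The function `f(k) = d̂(k) - 1`. -/
def hatSubOne (a b : ℝ) (d : ℝ → ℝ) (k : ℂ) : ℂ :=
  fourierHat a b d k - 1

/-- The zeros of `f = d̂ - 1` in the open strip `-c < Im k < 0`. -/
def stripZeros (a b : ℝ) (d : ℝ → ℝ) (c : ℝ) : Set ℂ :=
  {k : ℂ | -c < k.im ∧ k.im < 0 ∧ hatSubOne a b d k = 0}

/-- `f_c(u) = d̂'(u - ic) / (1 - d̂(u - ic)) - d̂'(u - ic)`. -/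
def lineFun (a b : ℝ) (d : ℝ → ℝ) (c u : ℝ) : ℂ :=
  deriv (fourierHat a b d) ((u : ℂ) - Complex.I * (c : ℂ)) /
      (1 - fourierHat a b d ((u : ℂ) - Complex.I * (c : ℂ))) -
    deriv (fourierHat a b d) ((u : ℂ) - Complex.I * (c : ℂ))

/-- `E(c, x) = (1 / (2πi)) ∫_ℝ f_c(u) e^{-iux} du`. -/
def errorTerm (a b : ℝ) (d : ℝ → ℝ) (c x : ℝ) : ℂ :=
  1 / (2 * (Real.pi : ℂ) * Complex.I) *
    ∫ u : ℝ, lineFun a b d c u * Complex.exp (-(Complex.I * (u : ℂ) * (x : ℂ)))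

/-- `(1 / x) (1 + ∑_k m(k) e^{-ikx} + E(c, x) e^{-cx})`, where `k` runs over the zeros of `f` in
the strip `-c < Im k < 0` and `m(k)` is the order of vanishing of `f` at `k`. -/
def expansion (a b : ℝ) (d : ℝ → ℝ) (c x : ℝ) : ℂ :=
  1 / (x : ℂ) *
    (1 + (∑ᶠ k ∈ stripZeros a b d c,
        (analyticOrderNatAt (hatSubOne a b d) k : ℂ) *
          Complex.exp (-(Complex.I * k * (x : ℂ)))) +
      errorTerm a b d c x * Complex.exp (-((c : ℂ) * (x : ℂ))))

end

open MeasureTheory FourierTransform Filter Topology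

/-! Write A for the transform of d. Multiplication by ix corresponds to d/dk, so i x d^{*n}(x) / n
has transform A' A^{n-1}. On the line Im k = 1 one has |A| ≤ e^{-a} < 1, and summing the geometric
series over n ≥ 2 gives i x (F_d(x) - d(x)) = (1/2π) ∫ A' A / (1 - A) e^{-ikx} dk over Im k = 1
(`convSeries_sub_mul_eq_integral`). The term n = 1 is split off because d may jump at a and b, so
that A' need not be integrable. By Plancherel A and A' are square integrable on every horizontal
line, so A' A is integrable.

The line is then moved down to Im k = -c. The integrand is the logarithmic derivative of A - 1 times
-A e^{-ikx}, so its poles are simple and lie at the zeros of A - 1, with residue -m(k) e^{-ikx}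
since A = 1 there. No zero has Im k > 0. The only real one is k = 0, which is simple because A'(0)
is i times the mean of d; it produces the summand 1. The integral left on the lower line is the
error term, since A' / (1 - A) - A' = A' A / (1 - A).

A Riemann–Lebesgue lemma uniform in strips (`fourierLaplace_small`) makes the zeros finite in
number, the vertical sides negligible and 1 / (1 - A) bounded on zero-free lines. The residue
theorem (`integral_horizontal_sub_eq_sum`) is obtained by subtracting the principal parts, applying
Cauchy's theorem to the remainder, and integrating 1 / (k - z) explicitly. -/

/-! ### Plancherel for the Fourier integral -/

open SchwartzMap in
/-- An integrable and square integrable function on the line has a square integrable Fourier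
transform. -/
theorem memLp_two_fourier {ψ : ℝ → ℂ} (h1 : Integrable ψ) (h2 : MemLp ψ 2) :
    MemLp (𝓕 ψ) 2 := by
  set F : Lp ℂ 2 (volume : Measure ℝ) := 𝓕 (h2.toLp ψ) with hF
  have hcont : Continuous (𝓕 ψ) := VectorFourier.fourierIntegral_continuous
    Real.continuous_fourierChar (by exact continuous_inner) h1
  -- The Fourier transform on `Lp` and the Fourier integral agree almost everywhere because both,
  -- tested against a smooth compactly supported g, give ∫ ψ 𝓕 g.
  have key : ∀ᵐ x, F x = 𝓕 ψ x := by
    refine ae_eq_of_integral_contDiff_smul_eq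
      ((Lp.memLp F).locallyIntegrable (by norm_num)) hcont.locallyIntegrable ?_
    intro g g_smooth g_cpt
    have hg₁ : HasCompactSupport (Complex.ofRealCLM ∘ g) := g_cpt.comp_left rfl
    have hg₂ : ContDiff ℝ (⊤ : ℕ∞) (Complex.ofRealCLM ∘ g) := by fun_prop
    set G : 𝓢(ℝ, ℂ) := hg₁.toSchwartzMap hg₂ with hG
    have hGx : ∀ x, G x = (g x : ℂ) := fun x => rfl
    have e1 : ∫ x, g x • F x = (Lp.toTemperedDistribution F) G := by
      rw [Lp.toTemperedDistribution_apply]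
      simp [hGx]
    have e2 : (Lp.toTemperedDistribution F) G
        = (Lp.toTemperedDistribution (h2.toLp ψ)) (𝓕 G) := by
      rw [hF, ← Lp.fourier_toTemperedDistribution_eq]
      rfl
    have e3 : (Lp.toTemperedDistribution (h2.toLp ψ)) (𝓕 G) = ∫ x, ψ x • (𝓕 (G : ℝ → ℂ)) x := by
      rw [Lp.toTemperedDistribution_apply]
      refine integral_congr_ae ?_
      filter_upwards [h2.coeFn_toLp] with x hx
      rw [hx, smul_eq_mul, smul_eq_mul, mul_comm, SchwartzMap.fourier_coe]
    have e4 : ∫ x, 𝓕 ψ x • G x = ∫ x, ψ x • (𝓕 (G : ℝ → ℂ)) x := by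
      have := VectorFourier.integral_fourierIntegral_smul_eq_flip (L := innerₗ ℝ)
        Real.continuous_fourierChar continuous_inner h1 (SchwartzMap.integrable (μ := volume) G)
      simpa using! this
    rw [e1, e2, e3, ← e4]
    congr with x
    simp [hGx, mul_comm]
  exact (memLp_congr_ae key).1 (Lp.memLp F)

/-! ### The Fourier–Laplace transform of bounded, compactly supported functions -/

/-- The Fourier–Laplace transform `k ↦ ∫ ψ(x) e^{ikx} dx`. -/
noncomputable def fourierLaplace (ψ : ℝ → ℂ) (k : ℂ) : ℂ :=
  ∫ x : ℝ, ψ x * Complex.exp (Complex.I * k * (x : ℂ))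

/-- Bounded measurable functions with compact support. -/
structure IsBddCompact (ψ : ℝ → ℂ) : Prop where
  aesm : AEStronglyMeasurable ψ
  bdd : ∃ M, ∀ x, ‖ψ x‖ ≤ M
  supp : HasCompactSupport ψ

namespace IsBddCompact

variable {ψ : ℝ → ℂ}

/-- Applied to the weights e^{ikx} and ix, this makes shifts and derivatives of a transform again
transforms of functions in the class. -/
theorem mul_continuous (h : IsBddCompact ψ) {g : ℝ → ℂ} (hg : Continuous g) :
    IsBddCompact (fun x => ψ x * g x) := by
  obtain ⟨M, hM⟩ := h.bdd
  obtain ⟨C, hC⟩ := h.supp.isCompact.exists_bound_of_continuousOn hg.continuousOn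
  refine ⟨h.aesm.mul hg.aestronglyMeasurable, ⟨M * |C|, fun x => ?_⟩, h.supp.mul_right⟩
  have hM0 : 0 ≤ M := (norm_nonneg _).trans (hM x)
  by_cases hx : x ∈ tsupport ψ
  · rw [norm_mul]
    exact mul_le_mul (hM x) ((hC x hx).trans (le_abs_self C)) (norm_nonneg _) hM0
  · rw [image_eq_zero_of_notMem_tsupport hx, zero_mul, norm_zero]
    positivity

theorem memLp (h : IsBddCompact ψ) (p : ENNReal) : MemLp ψ p := by
  obtain ⟨M, hM⟩ := h.bdd
  have hK := h.supp.isCompact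
  have : (tsupport ψ).indicator ψ = ψ := by
    rw [Set.indicator_eq_self]; exact subset_tsupport ψ
  rw [← this, memLp_indicator_iff_restrict hK.measurableSet]
  have : IsFiniteMeasure (volume.restrict (tsupport ψ)) :=
    isFiniteMeasure_restrict.2 hK.measure_lt_top.ne
  exact MemLp.of_bound h.aesm.restrict M (ae_of_all _ hM)

theorem integrable (h : IsBddCompact ψ) : Integrable ψ :=
  memLp_one_iff_integrable.1 (h.memLp 1)

theorem mul_exp (h : IsBddCompact ψ) (k : ℂ) :
    IsBddCompact (fun x => ψ x * Complex.exp (Complex.I * k * (x : ℂ))) :=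
  h.mul_continuous (by fun_prop)

theorem mul_deriv (h : IsBddCompact ψ) :
    IsBddCompact (fun x => ψ x * (Complex.I * (x : ℂ))) :=
  h.mul_continuous (by fun_prop)

theorem hasDerivAt_fourierLaplace (h : IsBddCompact ψ) (k : ℂ) :
    HasDerivAt (fourierLaplace ψ) (fourierLaplace (fun x => ψ x * (Complex.I * (x : ℂ))) k) k := by
  refine (hasDerivAt_integral_of_dominated_loc_of_deriv_le
    (F := fun k (x : ℝ) => ψ x * Complex.exp (Complex.I * k * (x : ℂ)))
    (F' := fun k (x : ℝ) => ψ x * (Complex.I * (x : ℂ)) * Complex.exp (Complex.I * k * (x : ℂ)))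
    -- For w in the unit ball around k, |e^{iwx}| ≤ e^{(‖k‖ + 1)|x|}.
    (bound := fun x => ‖ψ x * ((|x| * Real.exp ((‖k‖ + 1) * |x|) : ℝ) : ℂ)‖)
    (Metric.ball_mem_nhds k one_pos) (.of_forall fun w => (h.mul_exp w).aesm)
    (h.mul_exp k).integrable (h.mul_deriv.mul_exp k).aesm (.of_forall fun x w hw => ?_)
    (h.mul_continuous (by fun_prop)).integrable.norm (.of_forall fun x w _ => ?_)).2
  · rw [norm_mul, norm_mul, norm_mul, norm_mul, mul_assoc, Complex.norm_I, one_mul,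
      Complex.norm_real, Complex.norm_real, Complex.norm_exp, Real.norm_eq_abs,
      Real.norm_of_nonneg (by positivity)]
    gcongr
    have hw' : ‖w‖ ≤ ‖k‖ + 1 := by
      have : ‖w - k‖ < 1 := by simpa [dist_eq_norm] using hw
      linarith [norm_sub_norm_le w k]
    calc (Complex.I * w * (x : ℂ)).re ≤ ‖Complex.I * w * (x : ℂ)‖ := Complex.re_le_norm _
      _ = ‖w‖ * |x| := by simp
      _ ≤ _ := by gcongr
  · have h1 : HasDerivAt (fun w : ℂ => Complex.I * w * (x : ℂ)) (Complex.I * (x : ℂ)) w := by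
      simpa using ((hasDerivAt_id w).const_mul Complex.I).mul_const (x : ℂ)
    convert! (h1.cexp.const_mul (ψ x)) using 1
    ring

theorem deriv_fourierLaplace (h : IsBddCompact ψ) :
    deriv (fourierLaplace ψ) = fourierLaplace (fun x => ψ x * (Complex.I * (x : ℂ))) :=
  funext fun k => (h.hasDerivAt_fourierLaplace k).deriv

theorem differentiable_fourierLaplace (h : IsBddCompact ψ) :
    Differentiable ℂ (fourierLaplace ψ) :=
  fun k => (h.hasDerivAt_fourierLaplace k).differentiableAt

end IsBddCompact

theorem fourierLaplace_add (ψ : ℝ → ℂ) (k w : ℂ) :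
    fourierLaplace ψ (k + w) =
      fourierLaplace (fun x => ψ x * Complex.exp (Complex.I * w * (x : ℂ))) k := by
  refine integral_congr_ae (.of_forall fun x => ?_)
  simp only [mul_assoc, ← Complex.exp_add]
  ring_nf

/-- The kernel of `𝓕` is e^{-2πixv}, whence the sign and the factor 2π. With `fourierLaplace_add`,
which trades a shift for a weight, every horizontal line reduces to this case. -/
theorem fourierLaplace_ofReal (ψ : ℝ → ℂ) (u : ℝ) :
    fourierLaplace ψ u = 𝓕 ψ (-(2 * Real.pi)⁻¹ * u) := by
  rw [Real.fourier_real_eq_integral_exp_smul]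
  refine integral_congr_ae (.of_forall fun x => ?_)
  simp only [smul_eq_mul]
  rw [mul_comm]
  congr 2
  have : (Real.pi : ℂ) ≠ 0 := by exact_mod_cast Real.pi_ne_zero
  push_cast
  field_simp

/-! ### Square integrability, uniform decay and inversion on horizontal lines -/

namespace IsBddCompact

variable {ψ : ℝ → ℂ}

theorem memLp_two_fourierLaplace (h : IsBddCompact ψ) (w : ℂ) :
    MemLp (fun u : ℝ => fourierLaplace ψ (u + w)) 2 := by
  have hcont : Continuous fun u : ℝ => fourierLaplace ψ (u + w) :=
    h.differentiable_fourierLaplace.continuous.comp (by fun_prop)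
  rw [memLp_two_iff_integrable_sq_norm hcont.aestronglyMeasurable]
  simp_rw [fourierLaplace_add, fourierLaplace_ofReal]
  have h' := h.mul_exp w
  have hF := memLp_two_fourier h'.integrable (h'.memLp 2)
  have hc : -(2 * Real.pi)⁻¹ ≠ 0 := by simp [Real.pi_ne_zero]
  rw [memLp_two_iff_integrable_sq_norm hF.1] at hF
  exact (integrable_comp_mul_left_iff _ hc).2 hF

theorem tendsto_fourierLaplace_cocompact (ψ : ℝ → ℂ) (w : ℂ) :
    Tendsto (fun u : ℝ => fourierLaplace ψ (u + w)) (cocompact ℝ) (𝓝 0) := by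
  simp_rw [fourierLaplace_add, fourierLaplace_ofReal]
  have hc : -(2 * Real.pi)⁻¹ ≠ 0 := by simp [Real.pi_ne_zero]
  exact (Real.zero_at_infty_fourier _).comp
    (Homeomorph.mulLeft₀ _ hc).isClosedEmbedding.tendsto_cocompact

theorem norm_fourierLaplace_le (h : IsBddCompact ψ) (Y : ℝ) :
    ∃ C, ∀ k : ℂ, |k.im| ≤ Y → ‖fourierLaplace ψ k‖ ≤ C := by
  refine ⟨∫ x, ‖ψ x * ((Real.exp (Y * |x|) : ℝ) : ℂ)‖, fun k hk => ?_⟩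
  refine norm_integral_le_of_norm_le (h.mul_continuous (by fun_prop)).integrable.norm
    (.of_forall fun x => ?_)
  rw [norm_mul, norm_mul, Complex.norm_exp, Complex.norm_real, Real.norm_of_nonneg (by positivity)]
  gcongr
  calc (Complex.I * k * (x : ℂ)).re = -(k.im * x) := by simp
    _ ≤ |k.im * x| := neg_le_abs _
    _ = |k.im| * |x| := abs_mul _ _
    _ ≤ _ := by gcongr

/-- The Riemann–Lebesgue lemma, uniformly in horizontal strips. -/
theorem fourierLaplace_small (h : IsBddCompact ψ) (Y : ℝ) {ε : ℝ} (hε : 0 < ε) :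
    ∃ T : ℝ, ∀ k : ℂ, |k.im| ≤ Y → T ≤ |k.re| → ‖fourierLaplace ψ k‖ ≤ ε := by
  have hK : IsCompact (Set.Icc (-Y) Y) := isCompact_Icc
  obtain ⟨C, hC⟩ := h.mul_deriv.norm_fourierLaplace_le Y
  -- The derivative is bounded on the strip, so smallness on one horizontal line passes to nearby
  -- lines; compactness of [-Y, Y] then makes it uniform.
  have hlip : ∀ k ∈ {k : ℂ | |k.im| ≤ Y}, ∀ k' ∈ {k : ℂ | |k.im| ≤ Y},
      ‖fourierLaplace ψ k' - fourierLaplace ψ k‖ ≤ C * ‖k' - k‖ := by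
    intro k hk k' hk'
    have hconv : Convex ℝ {k : ℂ | |k.im| ≤ Y} := by
      have : {k : ℂ | |k.im| ≤ Y} = Complex.imLm ⁻¹' (Set.Icc (-Y) Y) := by
        ext k; simp [abs_le]
      rw [this]
      exact (convex_Icc (-Y) Y).linear_preimage Complex.imLm
    exact hconv.norm_image_sub_le_of_norm_hasDerivWithin_le
      (fun x _ => (h.hasDerivAt_fourierLaplace x).hasDerivWithinAt) (fun x hx => hC x hx) hk hk'
  have hev : ∀ᶠ u : ℝ in cocompact ℝ, ∀ y ∈ Set.Icc (-Y) Y,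
      ‖fourierLaplace ψ ((u : ℂ) + Complex.I * y)‖ ≤ ε := by
    have hP : ∀ y ∈ Set.Icc (-Y) Y, ∀ᶠ z : ℝ × ℝ in cocompact ℝ ×ˢ 𝓝 y,
        z.2 ∈ Set.Icc (-Y) Y → ‖fourierLaplace ψ ((z.1 : ℂ) + Complex.I * z.2)‖ ≤ ε := by
      intro y hy
      have e1 : ∀ᶠ u : ℝ in cocompact ℝ,
          ‖fourierLaplace ψ ((u : ℂ) + Complex.I * y)‖ ≤ ε / 2 := by
        have := (tendsto_fourierLaplace_cocompact ψ (Complex.I * y)).norm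
        rw [norm_zero] at this
        exact this.eventually_le_const (by positivity)
      have e2 : ∀ᶠ y' : ℝ in 𝓝 y, |C| * |y' - y| ≤ ε / 2 := by
        have : Tendsto (fun y' : ℝ => |C| * |y' - y|) (𝓝 y) (𝓝 (|C| * |y - y|)) :=
          (by fun_prop : Continuous fun y' : ℝ => |C| * |y' - y|).tendsto y
        rw [sub_self, abs_zero, mul_zero] at this
        exact this.eventually_le_const (by positivity)
      filter_upwards [e1.prod_mk e2] with z hz hz2
      have h3 := hlip ((z.1 : ℂ) + Complex.I * y) (by simpa [abs_le] using hy)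
        ((z.1 : ℂ) + Complex.I * z.2) (by simpa [abs_le] using hz2)
      have h4 : ‖((z.1 : ℂ) + Complex.I * z.2) - ((z.1 : ℂ) + Complex.I * y)‖ = |z.2 - y| := by
        rw [add_sub_add_left_eq_sub, ← mul_sub, norm_mul, Complex.norm_I, one_mul,
          ← Complex.ofReal_sub, Complex.norm_real, Real.norm_eq_abs]
      rw [h4] at h3
      have h5 : C * |z.2 - y| ≤ |C| * |z.2 - y| := by gcongr; exact le_abs_self C
      have h6 := norm_sub_norm_le (fourierLaplace ψ ((z.1 : ℂ) + Complex.I * z.2))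
        (fourierLaplace ψ ((z.1 : ℂ) + Complex.I * y))
      linarith [hz.1, hz.2]
    have := hK.mem_prod_nhdsSet_of_forall (l := cocompact ℝ) (s := {z : ℝ × ℝ |
        z.2 ∈ Set.Icc (-Y) Y → ‖fourierLaplace ψ ((z.1 : ℂ) + Complex.I * z.2)‖ ≤ ε}) hP
    exact (Filter.Eventually.curry this).mono fun u hu y hy =>
      hu.self_of_nhdsSet y hy hy
  rw [cocompact_eq_atBot_atTop, eventually_sup, eventually_atBot, eventually_atTop] at hev
  obtain ⟨⟨r, hr⟩, s, hs⟩ := hev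
  refine ⟨max (-r) s, fun k hk hk' => ?_⟩
  have hk'' := max_le_iff.1 hk'
  have : ‖fourierLaplace ψ ((k.re : ℂ) + Complex.I * k.im)‖ ≤ ε := by
    rcases le_total 0 k.re with h0 | h0
    · rw [abs_of_nonneg h0] at hk''
      exact hs _ hk''.2 _ (abs_le.1 hk)
    · rw [abs_of_nonpos h0] at hk''
      exact hr _ (by linarith) _ (abs_le.1 hk)
  rwa [mul_comm, Complex.re_add_im] at this

/-- Fourier inversion for ψ(x) e^{iwx}, with the weight removed afterwards; continuity of ψ makes it
hold at every point. -/
theorem fourierLaplace_inversion (h : IsBddCompact ψ) (hc : Continuous ψ) (w : ℂ)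
    (hi : Integrable fun u : ℝ => fourierLaplace ψ (u + w)) (x : ℝ) :
    ψ x = 1 / (2 * (Real.pi : ℂ)) *
      ∫ u : ℝ, fourierLaplace ψ (u + w) * Complex.exp (-(Complex.I * (u + w) * x)) := by
  have hc' : -(2 * Real.pi)⁻¹ ≠ 0 := by simp [Real.pi_ne_zero]
  set φ : ℝ → ℂ := fun x => ψ x * Complex.exp (Complex.I * w * (x : ℂ)) with hφ
  have hφc : Continuous φ := by fun_prop
  simp_rw [fourierLaplace_add, fourierLaplace_ofReal, ← hφ] at hi ⊢
  have hF : Integrable (𝓕 φ) := (integrable_comp_mul_left_iff _ hc').1 hi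
  have hinv : 𝓕⁻ (𝓕 φ) x = φ x := (h.mul_exp w).integrable.fourierInv_fourier_eq hF hφc.continuousAt
  have hψ : ψ x = φ x * Complex.exp (-(Complex.I * w * x)) := by
    rw [hφ]; simp [mul_assoc, ← Complex.exp_add]
  rw [hψ, ← hinv, Real.fourierInv_eq']
  have := Measure.integral_comp_mul_left
    (fun v : ℝ => Complex.exp (2 * Real.pi * v * x * Complex.I) * 𝓕 φ v) (-(2 * Real.pi)⁻¹)
  rw [inv_neg, inv_inv, abs_neg, abs_of_pos Real.two_pi_pos] at this
  have e : ∫ v : ℝ, Complex.exp (((2 * Real.pi * inner ℝ v x : ℝ) : ℂ) * Complex.I) • 𝓕 φ v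
      = ∫ v : ℝ, Complex.exp (2 * Real.pi * v * x * Complex.I) * 𝓕 φ v := by
    congr with v
    simp [mul_comm, mul_assoc, mul_left_comm]
  have hπ : (Real.pi : ℂ) ≠ 0 := by exact_mod_cast Real.pi_ne_zero
  have e2 : ∫ v : ℝ, Complex.exp (2 * Real.pi * v * x * Complex.I) * 𝓕 φ v
     = 1 / (2 * (Real.pi : ℂ)) * ∫ u : ℝ, Complex.exp (-(Complex.I * u * x)) *
       𝓕 φ (-(2 * Real.pi)⁻¹ * u) := by
    have e3 : ∀ u : ℝ, Complex.exp (-(Complex.I * u * x)) =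
        Complex.exp (2 * Real.pi * ((-(2 * Real.pi)⁻¹ * u : ℝ) : ℂ) * x * Complex.I) := by
      intro u
      congr 1
      push_cast
      field_simp
    simp_rw [e3]
    rw [this, Complex.real_smul, ← mul_assoc, Complex.ofReal_mul, Complex.ofReal_ofNat,
      one_div_mul_cancel (by simp), one_mul]
  rw [e, e2, mul_assoc, ← integral_mul_const]
  congr 2 with u
  rw [mul_comm (Complex.exp _), mul_assoc, ← Complex.exp_add]
  ring_nf

end IsBddCompact

/-! ### Zeros of entire functions and partial fractions -/

theorem Differentiable.dslope_complex {f : ℂ → ℂ} (hf : Differentiable ℂ f) (z : ℂ) :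
    Differentiable ℂ (dslope f z) := by
  rw [← differentiableOn_univ] at hf ⊢
  exact (Complex.differentiableOn_dslope univ_mem).2 hf

/-- An entire function factors through its zero at a given point. -/
theorem Differentiable.exists_eq_pow_analyticOrderNatAt_mul {f : ℂ → ℂ} (hf : Differentiable ℂ f)
    {z : ℂ} (hz : analyticOrderAt f z ≠ ⊤) :
    ∃ q : ℂ → ℂ, Differentiable ℂ q ∧ q z ≠ 0 ∧
      ∀ k, f k = (k - z) ^ analyticOrderNatAt f z * q k := by
  induction hn : analyticOrderNatAt f z generalizing f with
  | zero =>
    refine ⟨f, hf, ?_, by simp⟩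
    have h0 : analyticOrderAt f z = 0 := by
      rw [← Nat.cast_analyticOrderNatAt hz, hn, Nat.cast_zero]
    exact ((analyticOrderAt_eq_zero.1 h0).resolve_left fun h => h (hf.analyticAt z))
  | succ n ih =>
    have h1 : analyticOrderAt f z ≠ 0 := by
      rw [← Nat.cast_analyticOrderNatAt hz, hn]; simp
    have hfz : f z = 0 := (analyticOrderAt_ne_zero.1 h1).2
    have hg := hf.dslope_complex z
    -- Dividing out one factor with `dslope` keeps the function entire and lowers its order by one.
    have hmul : f = (fun k => k - z) * dslope f z := by
      ext k
      have := sub_smul_dslope f z k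
      rw [hfz, sub_zero, smul_eq_mul] at this
      exact this.symm
    have hord : analyticOrderAt f z = 1 + analyticOrderAt (dslope f z) z := by
      conv_lhs => rw [hmul]
      rw [analyticOrderAt_mul (by fun_prop) (hg.analyticAt z)]
      congr 1
      exact analyticOrderAt_id_sub_const_self
    have hgt : analyticOrderAt (dslope f z) z ≠ ⊤ := by
      intro h; rw [h] at hord; exact hz (by simp [hord])
    have hgn : analyticOrderNatAt (dslope f z) z = n := by
      rw [← Nat.cast_analyticOrderNatAt hz, ← Nat.cast_analyticOrderNatAt hgt, hn] at hord
      norm_cast at hord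
      omega
    obtain ⟨q, hq, hqz, hq'⟩ := ih hg hgt hgn
    refine ⟨q, hq, hqz, fun k => ?_⟩
    rw [hmul, Pi.mul_apply, hq' k]
    ring

/-- An entire function factors through its zeros in a finite set. -/
theorem Differentiable.exists_eq_prod_mul {f : ℂ → ℂ} (hf : Differentiable ℂ f) (Z : Finset ℂ)
    (hZ : ∀ z ∈ Z, analyticOrderAt f z ≠ ⊤) :
    ∃ q : ℂ → ℂ, Differentiable ℂ q ∧ (∀ z ∈ Z, q z ≠ 0) ∧
      ∀ k, f k = (∏ z ∈ Z, (k - z) ^ analyticOrderNatAt f z) * q k := by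
  classical
  induction Z using Finset.induction_on with
  | empty => exact ⟨f, hf, by simp, by simp⟩
  | insert z Z hzZ ih =>
    obtain ⟨p, hp, hpZ, hfp⟩ := ih fun w hw => hZ w (Finset.mem_insert_of_mem hw)
    set P : ℂ → ℂ := fun k => ∏ w ∈ Z, (k - w) ^ analyticOrderNatAt f w with hP
    have hPd : Differentiable ℂ P := by fun_prop
    have hP0 : analyticOrderAt P z = 0 := by
      refine analyticOrderAt_eq_zero.2 (Or.inr ?_)
      refine Finset.prod_ne_zero_iff.2 fun w hw => pow_ne_zero _ (sub_ne_zero.2 ?_)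
      rintro rfl
      exact hzZ hw
    have hmul : f = P * p := funext hfp
    have hord : analyticOrderAt f z = analyticOrderAt p z := by
      conv_lhs => rw [hmul]
      rw [analyticOrderAt_mul (hPd.analyticAt z) (hp.analyticAt z), hP0, zero_add]
    have hordN : analyticOrderNatAt f z = analyticOrderNatAt p z := by
      simp [analyticOrderNatAt, hord]
    obtain ⟨q, hq, hqz, hpq⟩ := hp.exists_eq_pow_analyticOrderNatAt_mul
      (z := z) (hord ▸ hZ z (Finset.mem_insert_self _ _))
    refine ⟨q, hq, fun w hw => ?_, fun k => ?_⟩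
    · rcases Finset.mem_insert.1 hw with rfl | hw
      · exact hqz
      · intro h
        exact hpZ w hw (by rw [hpq w, h, mul_zero])
    · rw [Finset.prod_insert hzZ, hfp k, hpq k, hordN]
      ring

/-- Partial fraction decomposition of a logarithmic derivative, times an entire function. -/
theorem Differentiable.exists_logDeriv_mul_eq {f g : ℂ → ℂ} (hf : Differentiable ℂ f)
    (hg : Differentiable ℂ g) (Z : Finset ℂ) (S : Set ℂ)
    (hZ : ∀ z ∈ Z, analyticOrderAt f z ≠ ⊤) (hS : ∀ k ∈ S, f k = 0 → k ∈ Z) :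
    ∃ R : ℂ → ℂ, (∀ k ∈ S, DifferentiableAt ℂ R k) ∧ ∀ k ∈ S, k ∉ Z →
      logDeriv f k * g k = ∑ z ∈ Z, analyticOrderNatAt f z * g z / (k - z) + R k := by
  obtain ⟨q, hq, hqZ, hfq⟩ := hf.exists_eq_prod_mul Z hZ
  have hq0 : ∀ k ∈ S, q k ≠ 0 := fun k hk h =>
    hqZ k (hS k hk (by rw [hfq, h, mul_zero])) h
  -- Since g(k) / (k - z) = g(z) / (k - z) + `dslope g z k`, freezing g at the pole costs only an
  -- entire term, which goes into R.
  refine ⟨fun k => logDeriv q k * g k + ∑ z ∈ Z, analyticOrderNatAt f z * dslope g z k,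
    fun k hk => ?_, fun k hk hkZ => ?_⟩
  · have h1 : DifferentiableAt ℂ (logDeriv q) k :=
      (hq.deriv k).div (hq k) (hq0 k hk)
    have h2 : DifferentiableAt ℂ (fun k => ∑ z ∈ Z, analyticOrderNatAt f z * dslope g z k) k := by
      refine DifferentiableAt.fun_sum fun z _ => ?_
      exact (hg.dslope_complex z k).const_mul _
    exact (h1.mul (hg k)).add h2
  · have hkz : ∀ z ∈ Z, k - z ≠ 0 := fun z hz h => hkZ (by rwa [sub_eq_zero.1 h])
    have hlog : logDeriv f k = ∑ z ∈ Z, analyticOrderNatAt f z / (k - z) + logDeriv q k := by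
      have : f = fun k => (∏ z ∈ Z, (k - z) ^ analyticOrderNatAt f z) * q k := funext hfq
      conv_lhs => rw [this]
      rw [logDeriv_mul (f := fun k => ∏ z ∈ Z, (k - z) ^ analyticOrderNatAt f z) k
        (Finset.prod_ne_zero_iff.2 fun z hz => pow_ne_zero _ (hkz z hz)) (hq0 k hk)
        (by fun_prop) (hq k), logDeriv_prod]
      · congr 1
        refine Finset.sum_congr rfl fun z hz => ?_
        rw [logDeriv_fun_pow (by fun_prop)]
        simp [logDeriv_apply, div_eq_mul_inv]
      · exact fun z hz => pow_ne_zero _ (hkz z hz)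
      · exact fun z hz => by fun_prop
    simp only
    rw [hlog, add_mul, Finset.sum_mul, add_comm (logDeriv q k * g k) (∑ z ∈ Z, _), ← add_assoc,
      ← Finset.sum_add_distrib]
    congr 1
    refine Finset.sum_congr rfl fun z hz => ?_
    have := sub_smul_dslope g z k
    rw [smul_eq_mul] at this
    have hkz' := hkz z hz
    field_simp
    rw [this]
    ring

/-! ### Symmetric integrals of a simple pole along a line -/

/-- As Im w ≠ 0, (u + w) / T never meets the branch cut, so its logarithm is a primitive. Dividing
by T makes the endpoint values converge as T → ∞. -/
theorem intervalIntegral_inv_add_eq_log {w : ℂ} (hw : w.im ≠ 0) {T : ℝ} (hT : 0 < T) :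
    ∫ u in (-T)..T, ((u : ℂ) + w)⁻¹ = Complex.log (1 + w / T) - Complex.log (-1 + w / T) := by
  have hT' : (T : ℂ) ≠ 0 := by exact_mod_cast hT.ne'
  have hne : ∀ u : ℝ, (u : ℂ) + w ≠ 0 := fun u h => hw (by simpa using congrArg Complex.im h)
  have hd : ∀ u : ℝ, HasDerivAt (fun u : ℝ => Complex.log (((u : ℂ) + w) / T)) ((u : ℂ) + w)⁻¹ u := by
    intro u
    have h1 : HasDerivAt (fun u : ℝ => ((u : ℂ) + w) / T) (1 / T) u :=
      ((Complex.ofRealCLM.hasDerivAt (x := u)).add_const w).div_const (T : ℂ)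
    have hs : ((u : ℂ) + w) / T ∈ Complex.slitPlane := by
      refine Complex.mem_slitPlane_iff.2 (Or.inr ?_)
      rw [Complex.div_ofReal_im]
      simpa using ⟨hw, hT.ne'⟩
    convert! h1.clog_real hs using 1
    field_simp [hne u]
  rw [intervalIntegral.integral_eq_sub_of_hasDerivAt (fun u _ => hd u)]
  · congr 2
    · field_simp
    · push_cast; field_simp
  · exact Continuous.intervalIntegrable (Continuous.inv₀ (by fun_prop) hne) _ _

theorem tendsto_intervalIntegral_inv_add_of_im_pos {w : ℂ} (hw : 0 < w.im) :
    Tendsto (fun T : ℝ => ∫ u in (-T)..T, ((u : ℂ) + w)⁻¹) atTop (𝓝 (-(Real.pi * Complex.I))) := by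
  have hT : Tendsto (fun T : ℝ => w / (T : ℂ)) atTop (𝓝 0) := by
    have h := ((tendsto_inv_atTop_zero (𝕜 := ℝ)).ofReal).const_mul w
    simpa [div_eq_mul_inv] using h
  have h1 : Tendsto (fun T : ℝ => Complex.log (1 + w / T)) atTop (𝓝 0) := by
    have := (continuousAt_clog (x := 1) (by simp)).tendsto.comp
      (by simpa using hT.const_add 1 : Tendsto (fun T : ℝ => 1 + w / (T : ℂ)) atTop (𝓝 1))
    simpa using! this
  -- Here -1 + w / T approaches the branch cut from above, so the logarithm tends to +πi.
  have h2 : Tendsto (fun T : ℝ => Complex.log (-1 + w / T)) atTop (𝓝 (Real.pi * Complex.I)) := by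
    have h := Complex.tendsto_log_nhdsWithin_im_nonneg_of_re_neg_of_im_zero (z := -1)
      (by simp) (by simp)
    simp only [norm_neg, norm_one, Real.log_one, Complex.ofReal_zero, zero_add] at h
    refine h.comp (tendsto_nhdsWithin_iff.2 ⟨by simpa using hT.const_add (-1), ?_⟩)
    filter_upwards [eventually_gt_atTop 0] with T hT0
    simp [Complex.div_ofReal_im]
    positivity
  have h3 := h1.sub h2
  rw [zero_sub] at h3
  refine h3.congr' ?_
  filter_upwards [eventually_gt_atTop 0] with T hT0
  exact (intervalIntegral_inv_add_eq_log hw.ne' hT0).symm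

theorem tendsto_intervalIntegral_inv_add_of_im_neg {w : ℂ} (hw : w.im < 0) :
    Tendsto (fun T : ℝ => ∫ u in (-T)..T, ((u : ℂ) + w)⁻¹) atTop (𝓝 (Real.pi * Complex.I)) := by
  have h := tendsto_intervalIntegral_inv_add_of_im_pos (w := -w) (by simpa using hw)
  have e : ∀ T : ℝ, ∫ u in (-T)..T, ((u : ℂ) + w)⁻¹ = -∫ u in (-T)..T, ((u : ℂ) + -w)⁻¹ := by
    intro T
    have := intervalIntegral.integral_comp_neg (a := -T) (b := T)
      (fun u : ℝ => ((u : ℂ) + w)⁻¹)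
    rw [neg_neg] at this
    rw [← this, ← intervalIntegral.integral_neg]
    congr with u
    rw [← inv_neg]
    push_cast
    ring_nf
  simp_rw [e]
  simpa using! h.neg

/-! ### Moving the line of integration across simple poles -/

/-- The filter of points of a horizontal strip whose real part tends to infinity. -/
def stripEnds (y₁ y₂ : ℝ) : Filter ℂ :=
  comap (fun k : ℂ => |k.re|) atTop ⊓ 𝓟 {k : ℂ | k.im ∈ Set.Icc y₁ y₂}

theorem eventually_stripEnds_iff {y₁ y₂ : ℝ} {P : ℂ → Prop} :
    (∀ᶠ k in stripEnds y₁ y₂, P k) ↔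
      ∃ T : ℝ, ∀ k : ℂ, k.im ∈ Set.Icc y₁ y₂ → T ≤ |k.re| → P k := by
  rw [stripEnds, eventually_inf_principal, eventually_comap, eventually_atTop]
  constructor
  · rintro ⟨T, hT⟩
    exact ⟨T, fun k hk hk' => hT _ hk' k rfl hk⟩
  · rintro ⟨T, hT⟩
    exact ⟨T, fun b hb k hk hk' => hT k hk' (hk ▸ hb)⟩

theorem tendsto_inv_sub_stripEnds (y₁ y₂ : ℝ) (z : ℂ) :
    Tendsto (fun k : ℂ => (k - z)⁻¹) (stripEnds y₁ y₂) (𝓝 0) := by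
  refine tendsto_inv₀_cobounded.comp ?_
  rw [← tendsto_norm_atTop_iff_cobounded]
  have h1 : Tendsto (fun k : ℂ => |k.re| - |z.re|) (stripEnds y₁ y₂) atTop :=
    tendsto_atTop_add_const_right _ _ (tendsto_comap.mono_left inf_le_left)
  refine tendsto_atTop_mono (fun k => ?_) h1
  calc |k.re| - |z.re| ≤ |k.re - z.re| := abs_sub_abs_le_abs_sub _ _
    _ = |(k - z).re| := by simp
    _ ≤ _ := Complex.abs_re_le_norm _

/-- The side has fixed length and R is uniformly small on it. The abscissa `s` serves for both the
right side T and the left side -T. -/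
theorem tendsto_intervalIntegral_vertical {y₁ y₂ : ℝ} (hy : y₁ ≤ y₂) {R : ℂ → ℂ}
    (hR : Tendsto R (stripEnds y₁ y₂) (𝓝 0)) {s : ℝ → ℝ} (hs : Tendsto (fun T => |s T|) atTop atTop) :
    Tendsto (fun T : ℝ => ∫ y in y₁..y₂, R ((s T : ℂ) + y * Complex.I)) atTop (𝓝 0) := by
  rw [Metric.tendsto_nhds]
  intro ε hε
  have hε' : 0 < ε / (|y₂ - y₁| + 1) := by positivity
  obtain ⟨T₀, hT₀⟩ := eventually_stripEnds_iff.1 (Metric.tendsto_nhds.1 hR _ hε')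
  filter_upwards [hs.eventually_ge_atTop T₀] with T hT
  rw [dist_zero_right]
  refine (intervalIntegral.norm_integral_le_of_norm_le_const
    (C := ε / (|y₂ - y₁| + 1)) fun y hy' => ?_).trans_lt ?_
  · rw [Set.uIoc_of_le hy] at hy'
    have := hT₀ ((s T : ℂ) + y * Complex.I) (by simpa using ⟨hy'.1.le, hy'.2⟩) (by simpa using hT)
    rw [dist_zero_right] at this
    exact this.le
  · rw [div_mul_eq_mul_div, div_lt_iff₀ (by positivity)]
    nlinarith [abs_nonneg (y₂ - y₁)]

/-- The residue theorem for the difference of integrals over two horizontal lines, for a function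
with simple poles in between. -/
theorem integral_horizontal_sub_eq_sum {y₁ y₂ : ℝ} (hy : y₁ ≤ y₂) {H R : ℂ → ℂ} (Z : Finset ℂ)
    (c : ℂ → ℂ) (hZ : ∀ z ∈ Z, z.im ∈ Set.Ioo y₁ y₂)
    (hR : ∀ k : ℂ, k.im ∈ Set.Icc y₁ y₂ → DifferentiableAt ℂ R k)
    (hHR : ∀ k : ℂ, k.im ∈ Set.Icc y₁ y₂ → k ∉ Z → H k = ∑ z ∈ Z, c z / (k - z) + R k)
    (hH : Tendsto H (stripEnds y₁ y₂) (𝓝 0))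
    (h₁ : Integrable fun u : ℝ => H (u + y₁ * Complex.I))
    (h₂ : Integrable fun u : ℝ => H (u + y₂ * Complex.I)) :
    (∫ u : ℝ, H (u + y₁ * Complex.I)) - ∫ u : ℝ, H (u + y₂ * Complex.I) =
      2 * Real.pi * Complex.I * ∑ z ∈ Z, c z := by
  have hRz : Tendsto R (stripEnds y₁ y₂) (𝓝 0) := by
    have hsum : Tendsto (fun k => ∑ z ∈ Z, c z / (k - z)) (stripEnds y₁ y₂) (𝓝 0) := by
      have := tendsto_finsetSum Z fun z _ =>
        (tendsto_inv_sub_stripEnds y₁ y₂ z).const_mul (c z)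
      simpa [div_eq_mul_inv] using this
    have hd := hH.sub hsum
    rw [sub_zero] at hd
    refine hd.congr' ?_
    refine eventually_stripEnds_iff.2 ⟨∑ z ∈ Z, |z.re| + 1, fun k hk hk' => ?_⟩
    have hkZ : k ∉ Z := fun hkZ => by
      have := Finset.single_le_sum (f := fun z : ℂ => |z.re|) (fun z _ => abs_nonneg _) hkZ
      linarith
    simp only [hHR k hk hkZ]
    ring
  -- R need not be integrable on the line, as 1 / (k - z) is not, so its integral is taken as a
  -- symmetric limit; σ is the common limit for the poles.
  have hline : ∀ (y : ℝ) (σ : ℂ), y ∈ Set.Icc y₁ y₂ → (∀ z ∈ Z, z.im ≠ y) →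
      Integrable (fun u : ℝ => H (u + y * Complex.I)) →
      (∀ z ∈ Z, Tendsto (fun T : ℝ => ∫ u in (-T)..T, ((u : ℂ) + (y * Complex.I - z))⁻¹) atTop
        (𝓝 σ)) →
      Tendsto (fun T : ℝ => ∫ u in (-T)..T, R (u + y * Complex.I)) atTop
        (𝓝 ((∫ u : ℝ, H (u + y * Complex.I)) - (∑ z ∈ Z, c z) * σ)) := by
    intro y σ hy' hZy hi hσ
    have t1 := intervalIntegral_tendsto_integral hi tendsto_neg_atTop_atBot tendsto_id
    have t2 := tendsto_finsetSum Z fun z hz => (hσ z hz).const_mul (c z)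
    rw [← Finset.sum_mul] at t2
    refine (t1.sub t2).congr fun T => ?_
    have hint : ∀ z ∈ Z, IntervalIntegrable
        (fun u : ℝ => c z * ((u : ℂ) + (y * Complex.I - z))⁻¹) volume (-T) T := by
      intro z hz
      refine (Continuous.intervalIntegrable (continuous_const.mul (Continuous.inv₀ (by fun_prop)
        fun u h => hZy z hz ?_)) _ _)
      have := congrArg Complex.im h
      simp at this
      linarith
    simp_rw [← intervalIntegral.integral_const_mul]
    rw [← intervalIntegral.integral_finsetSum hint, id,
      ← intervalIntegral.integral_sub hi.intervalIntegrable]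
    · refine intervalIntegral.integral_congr fun u _ => ?_
      rw [hHR _ (by simpa using hy') fun hmem => hZy _ hmem (by simp)]
      simp [div_eq_mul_inv, add_sub_assoc]
    · have := IntervalIntegrable.sum Z hint
      convert! this using 1
      ext u
      simp
  -- Each pole contributes πi on the line below it and -πi on the line above; the difference is the
  -- 2πi of the residue theorem.
  have L1 := hline y₁ (Real.pi * Complex.I) ⟨le_rfl, hy⟩ (fun z hz => (hZ z hz).1.ne') h₁
    fun z hz => tendsto_intervalIntegral_inv_add_of_im_neg (by simpa using (hZ z hz).1)
  have L2 := hline y₂ (-(Real.pi * Complex.I)) ⟨hy, le_rfl⟩ (fun z hz => (hZ z hz).2.ne) h₂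
    fun z hz => tendsto_intervalIntegral_inv_add_of_im_pos (by simpa using (hZ z hz).2)
  have V1 := tendsto_intervalIntegral_vertical hy hRz (s := fun T => T) tendsto_abs_atTop_atTop
  have V2 := tendsto_intervalIntegral_vertical hy hRz (s := fun T => -T)
    (by simpa using tendsto_abs_atTop_atTop)
  have lim := ((L1.sub L2).add (V1.const_mul Complex.I)).sub (V2.const_mul Complex.I)
  have hzero : ∀ T : ℝ, (∫ u in (-T)..T, R (u + y₁ * Complex.I)) -
      (∫ u in (-T)..T, R (u + y₂ * Complex.I)) +
      Complex.I * (∫ y in y₁..y₂, R ((T : ℂ) + y * Complex.I)) -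
      Complex.I * (∫ y in y₁..y₂, R (((-T : ℝ) : ℂ) + y * Complex.I)) = 0 := by
    intro T
    have := Complex.integral_boundary_rect_eq_zero_of_differentiableOn R ⟨-T, y₁⟩ ⟨T, y₂⟩ ?_
    · simpa using this
    · intro k hk
      refine (hR k ?_).differentiableWithinAt
      have := (Complex.mem_reProdIm.1 hk).2
      rwa [Set.uIcc_of_le hy] at this
  have := tendsto_nhds_unique (tendsto_const_nhds.congr fun T => (hzero T).symm) lim
  linear_combination -this

/-! ### Convolutions -/

open Convolution ContinuousLinearMap in
theorem ofReal_convolution (f g : ℝ → ℝ) (x : ℝ) :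
    ((f ⋆[mul ℝ ℝ, volume] g) x : ℂ) =
      ((fun t => (f t : ℂ)) ⋆[mul ℂ ℂ, volume] fun t => (g t : ℂ)) x := by
  simp only [convolution, mul_apply']
  rw [← integral_complex_ofReal]
  simp

namespace IsBddCompact

open Convolution ContinuousLinearMap

variable {ψ φ : ℝ → ℂ}

theorem convolution (hψ : IsBddCompact ψ) (hφ : IsBddCompact φ) :
    IsBddCompact (ψ ⋆[mul ℂ ℂ, volume] φ) := by
  obtain ⟨M, hM⟩ := hφ.bdd
  refine ⟨(hψ.integrable.integrable_convolution (mul ℂ ℂ) hφ.integrable).aestronglyMeasurable,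
    ⟨∫ t, ‖ψ t‖ * M, fun x => ?_⟩, hψ.supp.convolution _ hφ.supp⟩
  refine norm_integral_le_of_norm_le (hψ.integrable.norm.mul_const M) (.of_forall fun t => ?_)
  rw [mul_apply', norm_mul]
  gcongr
  exact hM _

/-- The weight factors as e^{ikx} = e^{ikt} e^{ik(x-t)}, which reduces the claim to the integral of
a convolution. -/
theorem fourierLaplace_convolution (hψ : IsBddCompact ψ) (hφ : IsBddCompact φ) (k : ℂ) :
    fourierLaplace (ψ ⋆[mul ℂ ℂ, volume] φ) k = fourierLaplace ψ k * fourierLaplace φ k := by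
  have h := integral_convolution (mul ℂ ℂ) (hψ.mul_exp k).integrable (hφ.mul_exp k).integrable
    (μ := volume) (ν := volume)
  rw [mul_apply'] at h
  rw [fourierLaplace, fourierLaplace, fourierLaplace, ← h]
  congr with x
  simp only [MeasureTheory.convolution, mul_apply']
  rw [← integral_mul_const]
  congr with t
  have : Complex.exp (Complex.I * k * x) =
      Complex.exp (Complex.I * k * t) * Complex.exp (Complex.I * k * ((x - t : ℝ) : ℂ)) := by
    rw [← Complex.exp_add]
    push_cast
    ring_nf
  rw [this]
  ring

/-- Dominated convergence: for fixed x₀ the t with φ possibly discontinuous at x₀ - t form a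
countable, hence null, set. This allows for the jumps of d at a and b. -/
theorem continuous_convolution (hψ : IsBddCompact ψ) (hφ : IsBddCompact φ) {N : Set ℝ}
    (hN : N.Countable) (hc : ∀ x ∉ N, ContinuousAt φ x) :
    Continuous (ψ ⋆[mul ℂ ℂ, volume] φ) := by
  obtain ⟨M, hM⟩ := hφ.bdd
  refine continuous_iff_continuousAt.2 fun x₀ => ?_
  refine continuousAt_of_dominated (bound := fun t => ‖ψ t‖ * M)
    (.of_forall fun x => ?_) (.of_forall fun x => .of_forall fun t => ?_)
    (hψ.integrable.norm.mul_const M) ?_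
  · exact hψ.aesm.mul (hφ.aesm.comp_quasiMeasurePreserving
      (quasiMeasurePreserving_sub_left volume x))
  · rw [mul_apply', norm_mul]
    gcongr
    exact hM _
  · have : {t | x₀ - t ∈ N}.Countable :=
      hN.preimage_of_injOn (sub_right_injective.injOn)
    filter_upwards [this.ae_notMem volume] with t ht
    have h1 : ContinuousAt (fun x => φ (x - t)) x₀ :=
      ContinuousAt.comp (g := φ) (hc _ ht) (by fun_prop)
    exact continuousAt_const.mul h1

end IsBddCompact

/-! ### Convolution powers of the density -/

section Density

open ContinuousLinearMap

variable {a b : ℝ} {d : ℝ → ℝ}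

theorem isBddCompact_of_continuousOn_Icc (hd_supp : ∀ x, x ∉ Set.Icc a b → d x = 0)
    (hd_cont : ContinuousOn d (Set.Icc a b)) : IsBddCompact fun x => (d x : ℂ) := by
  have hind : (Set.Icc a b).indicator (fun x => (d x : ℂ)) = fun x => (d x : ℂ) := by
    rw [Set.indicator_eq_self]
    intro x hx
    by_contra h
    exact hx (by simp [hd_supp x h])
  have hcont : ContinuousOn (fun x => (d x : ℂ)) (Set.Icc a b) :=
    Complex.continuous_ofReal.comp_continuousOn hd_cont
  refine ⟨?_, ?_, HasCompactSupport.intro (isCompact_Icc (a := a) (b := b)) fun x hx => by simp [hd_supp x hx]⟩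
  · rw [← hind]
    exact (aestronglyMeasurable_indicator_iff measurableSet_Icc).2
      (hcont.aestronglyMeasurable measurableSet_Icc)
  · obtain ⟨M, hM⟩ := isCompact_Icc.exists_bound_of_continuousOn hcont
    refine ⟨|M|, fun x => ?_⟩
    by_cases hx : x ∈ Set.Icc a b
    · exact (hM x hx).trans (le_abs_self M)
    · simp [hd_supp x hx]

theorem convPow_eq_zero (hd_supp : ∀ x, x ∉ Set.Icc a b → d x = 0) (n : ℕ) {x : ℝ}
    (hx : x < (n + 1) * a) : convPow d (n + 1) x = 0 := by
  induction n generalizing x with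
  | zero =>
    exact hd_supp x fun h => by simp at hx; linarith [h.1]
  | succ n ih =>
    refine integral_eq_zero_of_ae (.of_forall fun t => ?_)
    simp only [mul_apply', Pi.zero_apply]
    rcases lt_or_ge t a with h | h
    · rw [hd_supp t fun h' => by linarith [h'.1], zero_mul]
    · rw [ih (by push_cast at hx; linarith), mul_zero]

theorem finite_convPow_ne_zero (ha : 0 < a) (hd_supp : ∀ x, x ∉ Set.Icc a b → d x = 0) (x : ℝ) :
    {n : ℕ | convPow d (n + 1) x ≠ 0}.Finite := by
  obtain ⟨N, hN⟩ := exists_nat_gt (x / a)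
  refine (Set.finite_lt_nat N).subset fun n hn => ?_
  by_contra h
  refine hn (convPow_eq_zero hd_supp n ?_)
  rw [div_lt_iff₀ ha] at hN
  have : (N : ℝ) ≤ n := by exact_mod_cast not_lt.1 h
  nlinarith

theorem fourierHat_eq_fourierLaplace (hab : a < b) (hd_supp : ∀ x, x ∉ Set.Icc a b → d x = 0) :
    fourierHat a b d = fourierLaplace fun x => (d x : ℂ) := by
  ext k
  rw [fourierHat, intervalIntegral.integral_of_le hab.le, ← integral_Icc_eq_integral_Ioc,
    fourierLaplace]
  exact setIntegral_eq_integral_of_forall_compl_eq_zero fun x hx => by simp [hd_supp x hx]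

theorem isBddCompact_convPow (hd : IsBddCompact fun x => (d x : ℂ)) (n : ℕ) :
    IsBddCompact fun x => (convPow d (n + 1) x : ℂ) := by
  induction n with
  | zero => exact hd
  | succ n ih =>
    have := hd.convolution ih
    simp_rw [convPow, ofReal_convolution]
    exact this

theorem fourierLaplace_convPow (hd : IsBddCompact fun x => (d x : ℂ)) (n : ℕ) (k : ℂ) :
    fourierLaplace (fun x => (convPow d (n + 1) x : ℂ)) k =
      fourierLaplace (fun x => (d x : ℂ)) k ^ (n + 1) := by
  induction n with
  | zero => simp [convPow]
  | succ n ih =>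
    have := hd.fourierLaplace_convolution (isBddCompact_convPow hd n) k
    simp_rw [convPow, ofReal_convolution]
    rw [pow_succ', ← ih, ← this]

theorem continuousAt_convPow (hd : IsBddCompact fun x => (d x : ℂ)) {N : Set ℝ}
    (hN : N.Countable) (hc : ∀ x ∉ N, ContinuousAt d x) (n : ℕ) :
    ∀ x ∉ N, ContinuousAt (fun x => (convPow d (n + 1) x : ℂ)) x := by
  induction n with
  | zero => exact fun x hx => Complex.continuous_ofReal.continuousAt.comp (hc x hx)
  | succ n ih =>
    intro x _
    have := hd.continuous_convolution (isBddCompact_convPow hd n) hN ih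
    simp_rw [convPow, ofReal_convolution]
    exact this.continuousAt

/-- One convolution already removes the jumps of d, so pointwise inversion is available from the
second power on. -/
theorem continuous_convPow (hd : IsBddCompact fun x => (d x : ℂ)) {N : Set ℝ}
    (hN : N.Countable) (hc : ∀ x ∉ N, ContinuousAt d x) (n : ℕ) :
    Continuous fun x => (convPow d (n + 2) x : ℂ) := by
  have := hd.continuous_convolution (isBddCompact_convPow hd n) hN (continuousAt_convPow hd hN hc n)
  simp_rw [convPow, ofReal_convolution]
  exact this

theorem continuousAt_of_continuousOn_Icc (hd_supp : ∀ x, x ∉ Set.Icc a b → d x = 0)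
    (hd_cont : ContinuousOn d (Set.Icc a b)) : ∀ x ∉ ({a, b} : Set ℝ), ContinuousAt d x := by
  intro x hx
  by_cases h : x ∈ Set.Icc a b
  · refine hd_cont.continuousAt (Icc_mem_nhds ?_ ?_)
    · exact lt_of_le_of_ne h.1 fun e => hx (by simp [e])
    · exact lt_of_le_of_ne h.2 fun e => hx (by simp [e])
  · refine continuousAt_const.congr (f := fun _ => (0 : ℝ)) ?_
    filter_upwards [isClosed_Icc.isOpen_compl.mem_nhds h] with y hy
    exact (hd_supp y hy).symm

/-- Both factors are square integrable by Plancherel. This is the source of absolute convergence for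
all terms with n ≥ 2. -/
theorem integrable_deriv_mul_fourierLaplace {ψ : ℝ → ℂ} (h : IsBddCompact ψ) (w : ℂ) :
    Integrable fun u : ℝ => deriv (fourierLaplace ψ) (u + w) * fourierLaplace ψ (u + w) := by
  rw [h.deriv_fourierLaplace]
  exact (h.mul_deriv.memLp_two_fourierLaplace w).integrable_mul (h.memLp_two_fourierLaplace w)

/-- The Fourier inversion formula for `x d^{*(n+2)}(x) / (n+2)`. -/
theorem mul_convPow_eq_integral (hd : IsBddCompact fun x => (d x : ℂ)) {N : Set ℝ}
    (hN : N.Countable) (hc : ∀ x ∉ N, ContinuousAt d x) (n : ℕ) (w : ℂ) (x : ℝ)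
    (hi : Integrable fun u : ℝ => fourierLaplace (fun x => (d x : ℂ)) (u + w) ^ (n + 1) *
      deriv (fourierLaplace fun x => (d x : ℂ)) (u + w)) :
    (convPow d (n + 2) x : ℂ) * (Complex.I * x) / (n + 2) = 1 / (2 * (Real.pi : ℂ)) *
      ∫ u : ℝ, fourierLaplace (fun x => (d x : ℂ)) (u + w) ^ (n + 1) *
        deriv (fourierLaplace fun x => (d x : ℂ)) (u + w) *
        Complex.exp (-(Complex.I * (u + w) * x)) := by
  set A := fourierLaplace fun x => (d x : ℂ) with hA
  have hn : (n + 2 : ℂ) ≠ 0 := by exact_mod_cast (by omega : n + 2 ≠ 0)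
  have hD := isBddCompact_convPow hd (n + 1)
  have hFL : fourierLaplace (fun x => (convPow d (n + 2) x : ℂ)) = fun k => A k ^ (n + 2) :=
    funext fun k => fourierLaplace_convPow hd (n + 1) k
  -- Differentiating the power produces the factor n + 2, which cancels the denominator of the
  -- series.
  have hder : fourierLaplace (fun x => (convPow d (n + 2) x : ℂ) * (Complex.I * (x : ℂ))) =
      fun k => (n + 2) * (A k ^ (n + 1) * deriv A k) := by
    rw [← hD.deriv_fourierLaplace, hFL]
    ext k
    rw [deriv_fun_pow (hd.differentiable_fourierLaplace k)]
    push_cast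
    simp [mul_assoc, hA]
  have hcont := continuous_convPow hd hN hc n
  have := hD.mul_deriv.fourierLaplace_inversion
    (by fun_prop) w (by rw [hder]; exact hi.const_mul _) x
  rw [this, hder]
  simp_rw [mul_assoc]
  rw [integral_const_mul, mul_left_comm, mul_div_cancel_left₀ _ hn]

end Density

/-! ### The transform on and above the real axis; the integral over Im k = 1 -/

section Density

variable {a b : ℝ} {d : ℝ → ℝ}

/-- On the support |e^{ikx}| = e^{-x Im k} ≤ e^{-a Im k}, and d has mass 1. -/
theorem norm_fourierLaplace_density_le (hd : IsBddCompact fun x => (d x : ℂ))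
    (hd_nonneg : ∀ x, 0 ≤ d x) (hd_supp : ∀ x, x ∉ Set.Icc a b → d x = 0)
    (hd_int : ∫ x, d x = 1) {k : ℂ} (hk : 0 ≤ k.im) :
    ‖fourierLaplace (fun x => (d x : ℂ)) k‖ ≤ Real.exp (-(a * k.im)) := by
  have hdi : Integrable d := by simpa using! hd.integrable.re
  have h : ‖fourierLaplace (fun x => (d x : ℂ)) k‖ ≤ ∫ x, d x * Real.exp (-(a * k.im)) := by
    refine norm_integral_le_of_norm_le (hdi.mul_const _) (.of_forall fun x => ?_)
    rw [norm_mul, Complex.norm_real, Real.norm_of_nonneg (hd_nonneg x), Complex.norm_exp]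
    by_cases hx : x ∈ Set.Icc a b
    · refine mul_le_mul_of_nonneg_left (Real.exp_le_exp.2 ?_) (hd_nonneg x)
      simp only [Complex.mul_re, Complex.mul_im, Complex.I_re, Complex.I_im, Complex.ofReal_re,
        Complex.ofReal_im]
      nlinarith [hx.1]
    · simp [hd_supp x hx]
  rwa [integral_mul_const, hd_int, one_mul] at h

/-- Taking real parts gives ∫ d (1 - cos ux) = 0 with nonnegative integrand. For u ≠ 0 the cosine
equals 1 only on a countable set, so d would vanish almost everywhere. -/
theorem eq_zero_of_fourierLaplace_density_eq_one (hd : IsBddCompact fun x => (d x : ℂ))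
    (hd_nonneg : ∀ x, 0 ≤ d x) (hd_int : ∫ x, d x = 1) {u : ℝ}
    (hu : fourierLaplace (fun x => (d x : ℂ)) u = 1) : u = 0 := by
  by_contra hne
  have hdi : Integrable d := by simpa using! hd.integrable.re
  have hei := (hd.mul_exp u).integrable
  have hre : ∫ x, d x * Real.cos (u * x) = 1 := by
    have h := congrArg Complex.re hu
    rw [Complex.one_re, fourierLaplace] at h
    rw [← h]
    have h2 := integral_re hei
    simp only [RCLike.re_eq_complex_re] at h2
    rw [← h2]
    refine integral_congr_ae (.of_forall fun x => ?_)
    simp [Complex.exp_re, mul_comm]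
  have hci : Integrable fun x => d x * Real.cos (u * x) := by
    have := (hd.mul_continuous (g := fun x : ℝ => (Real.cos (u * x) : ℂ)) (by fun_prop)).integrable.re
    simpa [← Complex.ofReal_cos] using! this
  have hz : ∫ x, (d x - d x * Real.cos (u * x)) = 0 := by
    rw [integral_sub hdi hci, hd_int, hre, sub_self]
  have hsubi : Integrable fun x => d x - d x * Real.cos (u * x) := hdi.sub hci
  rw [integral_eq_zero_iff_of_nonneg _ hsubi] at hz
  · have hcount : {x : ℝ | Real.cos (u * x) = 1}.Countable := by
      refine (Set.countable_range fun n : ℤ => (n * (2 * Real.pi) : ℝ) / u).mono fun x hx => ?_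
      obtain ⟨n, hn⟩ := (Real.cos_eq_one_iff _).1 hx
      exact ⟨n, by simp only [hn]; field_simp⟩
    have h0 : ∫ x, d x = 0 := by
      refine integral_eq_zero_of_ae ?_
      filter_upwards [hz, hcount.ae_notMem volume] with x hx hx'
      have : d x * (1 - Real.cos (u * x)) = 0 := by
        simpa [mul_sub] using hx
      exact (mul_eq_zero.1 this).resolve_right fun h => hx' (by linarith)
    rw [hd_int] at h0
    exact one_ne_zero h0
  · intro x
    have := mul_nonneg (hd_nonneg x) (sub_nonneg.2 (Real.cos_le_one (u * x)))
    simpa [mul_sub] using this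

/-- The derivative is i times the mean of d, which is at least a > 0. Hence the zero of A - 1 at the
origin is simple. -/
theorem deriv_fourierLaplace_density_zero_ne_zero (ha : 0 < a)
    (hd : IsBddCompact fun x => (d x : ℂ))
    (hd_nonneg : ∀ x, 0 ≤ d x) (hd_supp : ∀ x, x ∉ Set.Icc a b → d x = 0)
    (hd_int : ∫ x, d x = 1) : deriv (fourierLaplace fun x => (d x : ℂ)) 0 ≠ 0 := by
  have hdi : Integrable d := by simpa using! hd.integrable.re
  have hxi : Integrable fun x => d x * x := by
    have := (hd.mul_continuous (g := fun x : ℝ => (x : ℂ)) (by fun_prop)).integrable.re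
    simpa using! this
  have hval : deriv (fourierLaplace fun x => (d x : ℂ)) 0 =
      Complex.I * ((∫ x, d x * x : ℝ) : ℂ) := by
    rw [hd.deriv_fourierLaplace, fourierLaplace, ← integral_complex_ofReal, ← integral_const_mul]
    refine integral_congr_ae (.of_forall fun x => ?_)
    simp [mul_left_comm]
  have hpos : a ≤ ∫ x, d x * x := by
    have h : ∫ x, d x * a ≤ ∫ x, d x * x := by
      refine integral_mono (hdi.mul_const a) hxi fun x => ?_
      by_cases hx : x ∈ Set.Icc a b
      · exact mul_le_mul_of_nonneg_left hx.1 (hd_nonneg x)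
      · simp [hd_supp x hx]
    rwa [integral_mul_const, hd_int, one_mul] at h
  rw [hval]
  refine mul_ne_zero Complex.I_ne_zero ?_
  exact_mod_cast (ha.trans_le hpos).ne'

/-- The contour integral representation of `x (F_d(x) - d(x))` over the line `Im k = 1`. -/
theorem convSeries_sub_mul_eq_integral (ha : 0 < a)
    (hd_nonneg : ∀ x, 0 ≤ d x) (hd_supp : ∀ x, x ∉ Set.Icc a b → d x = 0)
    (hd_int : ∫ x, d x = 1) (hd_cont : ContinuousOn d (Set.Icc a b)) (x : ℝ) :
    ((convSeries d x : ℂ) - d x) * (Complex.I * x) = 1 / (2 * (Real.pi : ℂ)) *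
      ∫ u : ℝ, deriv (fourierLaplace fun x => (d x : ℂ)) (u + Complex.I) *
        fourierLaplace (fun x => (d x : ℂ)) (u + Complex.I) /
        (1 - fourierLaplace (fun x => (d x : ℂ)) (u + Complex.I)) *
        Complex.exp (-(Complex.I * (u + Complex.I) * x)) := by
  have hd := isBddCompact_of_continuousOn_Icc hd_supp hd_cont
  have hc := continuousAt_of_continuousOn_Icc hd_supp hd_cont
  have hN : ({a, b} : Set ℝ).Countable := Set.to_countable _
  set A := fourierLaplace fun x => (d x : ℂ) with hA
  have hAd : Differentiable ℂ A := hd.differentiable_fourierLaplace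
  have hAc : Continuous fun u : ℝ => A (u + Complex.I) := hAd.continuous.comp (by fun_prop)
  set ρ := Real.exp (-a) with hρ
  have hρ1 : ρ < 1 := by rw [hρ, Real.exp_lt_one_iff]; linarith
  have hAρ : ∀ u : ℝ, ‖A (u + Complex.I)‖ ≤ ρ := fun u => by
    simpa using norm_fourierLaplace_density_le hd hd_nonneg hd_supp hd_int
      (k := (u : ℂ) + Complex.I) (by simp)
  have hint := integrable_deriv_mul_fourierLaplace hd Complex.I
  rw [← hA] at hint
  have hpow : ∀ n : ℕ, ∀ u : ℝ, ‖A (u + Complex.I) ^ n‖ ≤ ρ ^ n := fun n u => by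
    rw [norm_pow]; gcongr; exact hAρ u
  have hintn : ∀ n : ℕ, Integrable fun u : ℝ =>
      A (u + Complex.I) ^ (n + 1) * deriv A (u + Complex.I) := fun n => by
    refine (hint.mul_bdd (hAc.pow n).aestronglyMeasurable (.of_forall (hpow n))).congr
      (.of_forall fun u => ?_)
    simp only [Pi.pow_apply]
    ring
  have hE : ∀ u : ℝ, ‖Complex.exp (-(Complex.I * (u + Complex.I) * x))‖ = Real.exp x := fun u => by
    rw [Complex.norm_exp]; simp
  set B : ℝ → ℂ := fun u => deriv A (u + Complex.I) * A (u + Complex.I) *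
    Complex.exp (-(Complex.I * (u + Complex.I) * x)) with hB
  have hBi : Integrable B := hint.mul_bdd (by fun_prop) (.of_forall fun u => (hE u).le)
  have hBn : ∀ n : ℕ, Integrable fun u : ℝ => A (u + Complex.I) ^ n * B u := fun n =>
    hBi.bdd_mul (hAc.pow n).aestronglyMeasurable (.of_forall (hpow n))
  -- The n-th integral is at most ρ^n ∫ ‖B‖, so sum and integral may be exchanged.
  have hsum := hasSum_integral_of_summable_integral_norm hBn (by
    refine Summable.of_nonneg_of_le (fun n => integral_nonneg fun u => norm_nonneg _)
      (fun n => ?_) ((summable_geometric_of_lt_one (Real.exp_pos _).le hρ1).mul_right (∫ u, ‖B u‖))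
    rw [← integral_const_mul]
    refine integral_mono (hBn n).norm (hBi.norm.const_mul _) fun u => ?_
    simp only [norm_mul]
    gcongr
    simpa using hpow n u)
  have htsum : ∀ u : ℝ, ∑' n : ℕ, A (u + Complex.I) ^ n * B u = deriv A (u + Complex.I) *
      A (u + Complex.I) / (1 - A (u + Complex.I)) *
      Complex.exp (-(Complex.I * (u + Complex.I) * x)) := fun u => by
    rw [tsum_mul_right, tsum_geometric_of_norm_lt_one ((hAρ u).trans_lt hρ1), hB]
    ring
  simp_rw [htsum] at hsum
  have hterm : ∀ n : ℕ, 1 / (2 * (Real.pi : ℂ)) * ∫ u : ℝ, A (u + Complex.I) ^ n * B u =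
      ((convPow d (n + 2) x / (n + 2 : ℝ) : ℝ) : ℂ) * (Complex.I * x) := fun n => by
    have := mul_convPow_eq_integral hd hN hc n Complex.I x (hintn n)
    push_cast
    rw [div_mul_eq_mul_div (convPow d (n + 2) x : ℂ), this]
    congr 2 with u
    simp only [hB]
    ring
  have hsum2 := hsum.mul_left (1 / (2 * (Real.pi : ℂ)))
  simp_rw [hterm] at hsum2
  have hsupp : Summable fun n : ℕ => convPow d (n + 1) x / ((n : ℝ) + 1) := by
    refine summable_of_hasFiniteSupport ((finite_convPow_ne_zero ha hd_supp x).subset ?_)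
    intro n hn h
    exact hn (by simp [h])
  -- Removing the index 0 from the series removes exactly the summand d(x).
  have hF : HasSum (fun n : ℕ => convPow d (n + 2) x / (n + 2 : ℝ)) (convSeries d x - d x) := by
    have e : (fun n : ℕ => convPow d (n + 2) x / (n + 2 : ℝ)) =
        fun n : ℕ => convPow d (n + 1 + 1) x / (((n + 1 : ℕ) : ℝ) + 1) := by
      ext n
      push_cast
      ring_nf
    have h := (hasSum_nat_add_iff' 1).2 hsupp.hasSum
    simp only [Finset.range_one, Finset.sum_singleton, CharP.cast_eq_zero, zero_add, div_one] at h
    rw [e]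
    exact h
  have hF2 := (Complex.hasSum_ofReal.2 hF).mul_right (Complex.I * x)
  rw [hsum2.unique hF2, Complex.ofReal_sub]

end Density

/-! ### Solutions of A = 1 in strips, and bounds on zero-free lines -/

namespace IsBddCompact

variable {ψ : ℝ → ℂ}

theorem tendsto_fourierLaplace_stripEnds (h : IsBddCompact ψ) (y₁ y₂ : ℝ) :
    Tendsto (fourierLaplace ψ) (stripEnds y₁ y₂) (𝓝 0) := by
  rw [Metric.tendsto_nhds]
  intro ε hε
  obtain ⟨T, hT⟩ := h.fourierLaplace_small (max |y₁| |y₂|) (half_pos hε)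
  refine eventually_stripEnds_iff.2 ⟨T, fun k hk hk' => ?_⟩
  rw [dist_zero_right]
  exact (hT k (abs_le_max_abs_abs hk.1 hk.2) hk').trans_lt (half_lt_self hε)

/-- Uniform decay confines the solutions to a compact rectangle, where they are isolated; `w`
witnesses that the analytic function is not identically 1. -/
theorem finite_fourierLaplace_eq_one (h : IsBddCompact ψ) {w : ℂ} (hw : fourierLaplace ψ w ≠ 1)
    (y₁ y₂ : ℝ) : {k : ℂ | k.im ∈ Set.Icc y₁ y₂ ∧ fourierLaplace ψ k = 1}.Finite := by
  obtain ⟨T, hT⟩ := eventually_stripEnds_iff.1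
    ((h.tendsto_fourierLaplace_stripEnds y₁ y₂).eventually_ne zero_ne_one)
  have hK : IsCompact (Set.Icc (-T) T ×ℂ Set.Icc y₁ y₂) := isCompact_Icc.reProdIm isCompact_Icc
  have han : AnalyticOnNhd ℂ (fun k => fourierLaplace ψ k - 1) Set.univ := fun k _ =>
    (h.differentiable_fourierLaplace.sub_const 1).analyticAt k
  have hcod := han.preimage_zero_mem_codiscrete (x := w) (sub_ne_zero.2 hw)
  refine (hK.finite_sdiff_of_mem_codiscreteWithin
    (Filter.codiscreteWithin_mono (Set.subset_univ _) hcod)).subset fun k hk => ?_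
  refine ⟨Complex.mem_reProdIm.2 ⟨?_, hk.1⟩, by simp [hk.2]⟩
  by_contra hre
  refine hT k hk.1 (le_of_not_gt fun hlt => hre ?_) hk.2
  exact ⟨(abs_lt.1 hlt).1.le, (abs_lt.1 hlt).2.le⟩

theorem analyticOrderAt_fourierLaplace_sub_one_ne_top (h : IsBddCompact ψ) {w : ℂ}
    (hw : fourierLaplace ψ w ≠ 1) (z : ℂ) :
    analyticOrderAt (fun k => fourierLaplace ψ k - 1) z ≠ ⊤ := by
  rw [Ne, AnalyticOnNhd.analyticOrderAt_eq_top_iff_eq_zero z fun z =>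
    (h.differentiable_fourierLaplace.sub_const 1).analyticAt z]
  exact fun h0 => sub_ne_zero.2 hw (congrFun h0 w)

theorem norm_inv_one_sub_fourierLaplace_le (h : IsBddCompact ψ) {y : ℝ}
    (hy : ∀ k : ℂ, k.im = y → fourierLaplace ψ k ≠ 1) :
    ∃ C, ∀ k : ℂ, k.im = y → ‖(1 - fourierLaplace ψ k)⁻¹‖ ≤ C := by
  obtain ⟨T, hT⟩ := h.fourierLaplace_small |y| (half_pos one_pos)
  have hK : IsCompact (Set.Icc (-T) T ×ℂ {y}) := isCompact_Icc.reProdIm isCompact_singleton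
  obtain ⟨C, hC⟩ := hK.exists_bound_of_continuousOn
    (f := fun k => (1 - fourierLaplace ψ k)⁻¹) (by
      refine ContinuousOn.inv₀ ?_ fun k hk => sub_ne_zero.2 (hy k (Complex.mem_reProdIm.1 hk).2).symm
      exact (continuous_const.sub h.differentiable_fourierLaplace.continuous).continuousOn)
  -- Beyond T the transform is at most 1/2 in norm, so the inverse is at most 2; C covers the
  -- compact segment in between.
  refine ⟨max C 2, fun k hk => ?_⟩
  rcases le_total T |k.re| with hre | hre
  · refine le_max_of_le_right ?_
    have h1 := hT k (by rw [hk]) hre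
    have h2 := norm_sub_norm_le 1 (fourierLaplace ψ k)
    rw [norm_one] at h2
    rw [norm_inv]
    exact inv_le_of_inv_le₀ (by norm_num) (by linarith)
  · exact le_max_of_le_left (hC k (Complex.mem_reProdIm.2 ⟨abs_le.1 hre, hk⟩))

theorem integrable_deriv_mul_div_one_sub (h : IsBddCompact ψ) {y : ℝ}
    (hy : ∀ k : ℂ, k.im = y → fourierLaplace ψ k ≠ 1) :
    Integrable fun u : ℝ => deriv (fourierLaplace ψ) (u + y * Complex.I) *
      fourierLaplace ψ (u + y * Complex.I) / (1 - fourierLaplace ψ (u + y * Complex.I)) := by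
  obtain ⟨C, hC⟩ := h.norm_inv_one_sub_fourierLaplace_le hy
  have hc : Continuous fun u : ℝ => (1 - fourierLaplace ψ (u + y * Complex.I))⁻¹ := by
    refine Continuous.inv₀ ?_ fun u => sub_ne_zero.2 (hy _ (by simp)).symm
    exact continuous_const.sub (h.differentiable_fourierLaplace.continuous.comp (by fun_prop))
  exact (integrable_deriv_mul_fourierLaplace h (y * Complex.I)).mul_bdd hc.aestronglyMeasurable
    (.of_forall fun u => hC _ (by simp))

end IsBddCompact

/-- Subtracting A' from A' / (1 - A) removes the n = 1 term and leaves the integrable function A' A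
/ (1 - A). -/
theorem lineFun_eq {a b : ℝ} {d : ℝ → ℝ} {c : ℝ} {A : ℂ → ℂ} (hA : fourierHat a b d = A)
    (hc : ∀ k : ℂ, k.im = -c → A k ≠ 1) (u : ℝ) :
    lineFun a b d c u = deriv A (u + (-c : ℝ) * Complex.I) * A (u + (-c : ℝ) * Complex.I) /
      (1 - A (u + (-c : ℝ) * Complex.I)) := by
  have e : (u : ℂ) - Complex.I * (c : ℂ) = u + (-c : ℝ) * Complex.I := by push_cast; ring
  have h0 : 1 - A (u + (-c : ℝ) * Complex.I) ≠ 0 := sub_ne_zero.2 (hc _ (by simp)).symm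
  rw [lineFun, hA, e]
  field_simp
  ring

/-! ### Assembling the expansion -/

section Density

variable {a b : ℝ} {d : ℝ → ℝ}

theorem fourierLaplace_density_ne_one (ha : 0 < a) (hd : IsBddCompact fun x => (d x : ℂ))
    (hd_nonneg : ∀ x, 0 ≤ d x) (hd_supp : ∀ x, x ∉ Set.Icc a b → d x = 0)
    (hd_int : ∫ x, d x = 1) {k : ℂ} (hk : 0 < k.im) :
    fourierLaplace (fun x => (d x : ℂ)) k ≠ 1 := by
  intro h
  have h1 := norm_fourierLaplace_density_le hd hd_nonneg hd_supp hd_int hk.le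
  rw [h, norm_one] at h1
  have : Real.exp (-(a * k.im)) < 1 := Real.exp_lt_one_iff.2 (by nlinarith)
  linarith

/-- The renewal-type expansion obtained by moving the line of integration past the zeros. -/
theorem convSeries_eq_add_expansion (ha : 0 < a) (hab : a < b)
    (hd_nonneg : ∀ x, 0 ≤ d x) (hd_supp : ∀ x, x ∉ Set.Icc a b → d x = 0)
    (hd_int : ∫ x, d x = 1) (hd_cont : ContinuousOn d (Set.Icc a b)) {c : ℝ} (hc : 0 < c)
    (hline : ∀ k : ℂ, k.im = -c → hatSubOne a b d k ≠ 0) {x : ℝ} (hx : 0 < x) :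
    (convSeries d x : ℂ) = d x + expansion a b d c x := by
  classical
  have hd := isBddCompact_of_continuousOn_Icc hd_supp hd_cont
  have hA' : fourierHat a b d = fourierLaplace fun x => (d x : ℂ) :=
    fourierHat_eq_fourierLaplace hab hd_supp
  have hbase := convSeries_sub_mul_eq_integral ha hd_nonneg hd_supp hd_int hd_cont x
  set A := fourierLaplace fun x => (d x : ℂ) with hA
  have hAd : Differentiable ℂ A := hd.differentiable_fourierLaplace
  have hup : ∀ k : ℂ, 0 < k.im → A k ≠ 1 := fun k hk =>
    fourierLaplace_density_ne_one ha hd hd_nonneg hd_supp hd_int hk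
  have hreal : ∀ k : ℂ, k.im = 0 → A k = 1 → k = 0 := fun k hk h => by
    have hk' : k = (k.re : ℂ) := Complex.ext rfl (by simpa using hk)
    rw [hk'] at h ⊢
    exact_mod_cast eq_zero_of_fourierLaplace_density_eq_one hd hd_nonneg hd_int h
  have hA0 : A 0 = 1 := by
    have : A 0 = ∫ x, (d x : ℂ) := by simp [hA, fourierLaplace]
    rw [this, integral_complex_ofReal, hd_int, Complex.ofReal_one]
  have hf : hatSubOne a b d = fun k => A k - 1 := by ext k; rw [hatSubOne, hA']
  have hfd : Differentiable ℂ fun k => A k - 1 := hAd.sub_const 1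
  rw [hf] at hline
  have hline' : ∀ k : ℂ, k.im = -c → A k ≠ 1 := fun k hk => sub_ne_zero.1 (hline k hk)
  have hone : ∀ k : ℂ, k.im = (1 : ℝ) → A k ≠ 1 := fun k hk => hup k (by rw [hk]; exact one_pos)
  have hI : A Complex.I ≠ 1 := hup _ (by simp)
  have hfin := hd.finite_fourierLaplace_eq_one hI (-c) 1
  rw [← hA] at hfin
  set Z := hfin.toFinset with hZ
  have hmemZ : ∀ k, k ∈ Z ↔ k.im ∈ Set.Icc (-c) 1 ∧ A k = 1 := fun k => hfin.mem_toFinset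
  have hZ0 : (0 : ℂ) ∈ Z := (hmemZ 0).2 ⟨by simp [hc.le], hA0⟩
  -- There is no zero on Im k = -c or above the real axis, and on the axis only 0, so erasing 0
  -- leaves the open strip.
  have hstrip : stripZeros a b d c = ((Z.erase 0 : Finset ℂ) : Set ℂ) := by
    ext k
    rw [stripZeros, hf, Finset.mem_coe, Finset.mem_erase, hmemZ]
    simp only [Set.mem_ofPred_eq, sub_eq_zero]
    constructor
    · rintro ⟨h1, h2, h3⟩
      exact ⟨by rintro rfl; simp at h2, ⟨h1.le, by linarith⟩, h3⟩
    · rintro ⟨h1, h2, h3⟩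
      refine ⟨lt_of_le_of_ne h2.1 fun e => hline' k e.symm h3, ?_, h3⟩
      rcases lt_trichotomy k.im 0 with h | h | h
      · exact h
      · exact absurd (hreal k h h3) h1
      · exact absurd h3 (hup k h)
  set m : ℂ → ℕ := analyticOrderNatAt fun k => A k - 1 with hm
  have hm0 : m 0 = 1 := by
    have h1 : analyticOrderAt (fun k => A k - 1) 0 = 1 :=
      (hfd.analyticAt 0).analyticOrderAt_eq_one_of_zero_deriv_ne_zero (by simp [hA0]) (by
        rw [deriv_sub_const]
        exact deriv_fourierLaplace_density_zero_ne_zero ha hd hd_nonneg hd_supp hd_int)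
    simp [hm, analyticOrderNatAt, h1]
  set e : ℂ → ℂ := fun k => Complex.exp (-(Complex.I * k * x)) with he
  set H : ℂ → ℂ := fun k => deriv A k * A k / (1 - A k) * e k with hH
  -- With this g, H is the logarithmic derivative of A - 1 times g; the minus sign turns A - 1 into
  -- 1 - A.
  obtain ⟨R, hR, hHR⟩ := hfd.exists_logDeriv_mul_eq (g := fun k => -(A k * e k))
    (by fun_prop) Z {k : ℂ | k.im ∈ Set.Icc (-c) 1}
    (fun z _ => hd.analyticOrderAt_fourierLaplace_sub_one_ne_top hI z)
    (fun k hk hk0 => (hmemZ k).2 ⟨hk, sub_eq_zero.1 hk0⟩)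
  have hshift : ∀ (y : ℝ), (∀ k : ℂ, k.im = y → A k ≠ 1) →
      Integrable fun u : ℝ => H (u + y * Complex.I) := fun y hy => by
    refine (hd.integrable_deriv_mul_div_one_sub hy).mul_bdd (c := Real.exp (y * x))
      (by fun_prop) (.of_forall fun u => ?_)
    rw [he, Complex.norm_exp]
    simp
  have hHlim : Tendsto H (stripEnds (-c) 1) (𝓝 0) := by
    have t1 : Tendsto A (stripEnds (-c) 1) (𝓝 0) := hd.tendsto_fourierLaplace_stripEnds (-c) 1
    have t2 : Tendsto (deriv A) (stripEnds (-c) 1) (𝓝 0) := by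
      rw [hA, hd.deriv_fourierLaplace]
      exact hd.mul_deriv.tendsto_fourierLaplace_stripEnds (-c) 1
    have t3 : Tendsto (fun k => deriv A k * A k / (1 - A k)) (stripEnds (-c) 1) (𝓝 0) := by
      have := (t2.mul t1).div (t1.const_sub 1) (by simp)
      simpa using! this
    refine t3.zero_mul_isBoundedUnder_le ?_
    refine isBoundedUnder_of_eventually_le (a := Real.exp x)
      (eventually_stripEnds_iff.2 ⟨0, fun k hk _ => ?_⟩)
    simp only [Function.comp, he]
    rw [Complex.norm_exp, Real.exp_le_exp]
    have := hk.2
    simp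
    nlinarith
  have hres := integral_horizontal_sub_eq_sum (by linarith) Z (fun z => m z * -(A z * e z))
    (fun z hz => ?_) hR (fun k hk hkZ => ?_) hHlim (hshift (-c) hline') (hshift 1 hone)
  rotate_left
  · have hz' := (hmemZ z).1 hz
    exact ⟨lt_of_le_of_ne hz'.1.1 fun e => hline' z e.symm hz'.2,
      lt_of_le_of_ne hz'.1.2 fun e => hone z e hz'.2⟩
  · rw [← hHR k hk hkZ, logDeriv_apply, deriv_sub_const, hH]
    have h1 : A k - 1 ≠ 0 := fun h => hkZ ((hmemZ k).2 ⟨hk, sub_eq_zero.1 h⟩)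
    have h2 : 1 - A k ≠ 0 := fun h => h1 (by linear_combination -h)
    simp only
    field_simp
    ring
  -- At each zero A = 1, so the residue is -m(z) e^{-izx}; the simple zero at 0 yields the summand
  -- 1.
  have hsum : ∑ z ∈ Z, m z * -(A z * e z) = -(1 + ∑ z ∈ Z.erase 0, m z * e z) := by
    rw [← Finset.add_sum_erase Z _ hZ0, hm0, hA0, neg_add, ← Finset.sum_neg_distrib]
    congr 1
    · simp [he]
    · refine Finset.sum_congr rfl fun z hz => ?_
      rw [((hmemZ z).1 (Finset.mem_of_mem_erase hz)).2]
      ring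
  have hfinsum : ∑ᶠ k ∈ stripZeros a b d c, (analyticOrderNatAt (hatSubOne a b d) k : ℂ) *
      Complex.exp (-(Complex.I * k * (x : ℂ))) = ∑ z ∈ Z.erase 0, m z * e z := by
    rw [hstrip, finsum_mem_coe_finset, hf]
  have hlow : ∫ u : ℝ, H (u + (-c : ℝ) * Complex.I) =
      (∫ u : ℝ, lineFun a b d c u * Complex.exp (-(Complex.I * (u : ℂ) * (x : ℂ)))) *
        Complex.exp (-((c : ℂ) * (x : ℂ))) := by
    rw [← integral_mul_const]
    congr with u
    rw [lineFun_eq hA' hline', mul_assoc, ← Complex.exp_add]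
    simp only [hH, he]
    congr 2
    push_cast
    linear_combination (c * x : ℂ) * Complex.I_sq
  have hupp : ∫ u : ℝ, H (u + (1 : ℝ) * Complex.I) =
      2 * Real.pi * (((convSeries d x : ℂ) - d x) * (Complex.I * x)) := by
    rw [hbase, ← mul_assoc, mul_one_div_cancel (by simp), one_mul]
    simp [hH, he]
  rw [hlow, hupp, hsum] at hres
  rw [expansion, hfinsum, errorTerm]
  have hπ : (Real.pi : ℂ) ≠ 0 := by exact_mod_cast Real.pi_ne_zero
  have hx' : (x : ℂ) ≠ 0 := by exact_mod_cast hx.ne'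
  have hII := Complex.I_ne_zero
  generalize (∫ u : ℝ, lineFun a b d c u * Complex.exp (-(Complex.I * (u : ℂ) * (x : ℂ)))) = J at *
  generalize Complex.exp (-((c : ℂ) * (x : ℂ))) = ec at *
  rw [← sub_eq_iff_eq_add']
  field_simp
  linear_combination -hres

end Density

theorem theorem1p1 (a b : ℝ) (ha : 0 < a) (hab : a < b) (d : ℝ → ℝ)
    (hd_nonneg : ∀ x, 0 ≤ d x)
    (hd_supp : ∀ x, x ∉ Set.Icc a b → d x = 0)
    (hd_int : ∫ x, d x = 1)
    (hd_cont : ContinuousOn d (Set.Icc a b))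
    (hd_smooth : ContDiffOn ℝ 2 d (Set.Ioo a b))
    (hd_ends : d a * d b ≠ 0) :
    (∀ x : ℝ, 0 < x → {n : ℕ | convPow d (n + 1) x ≠ 0}.Finite) ∧
    ∀ c : ℝ, 0 < c →
      (stripZeros a b d c).Finite ∧
      ((∀ k : ℂ, k.im = -c → hatSubOne a b d k ≠ 0) →
        (∀ x : ℝ, 0 < x → x ∉ Set.Icc a b →
          (convSeries d x : ℂ) = expansion a b d c x) ∧
        (∀ x : ℝ, 0 < x →
          (convSeries d x : ℂ) = (d x : ℂ) + expansion a b d c x) ∧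
        MeasureTheory.Integrable (lineFun a b d c) ∧
        (∀ x : ℝ, 0 < x →
          ‖errorTerm a b d c x‖ ≤ 1 / (2 * Real.pi) * ∫ u : ℝ, ‖lineFun a b d c u‖)) := by
  have hd := isBddCompact_of_continuousOn_Icc hd_supp hd_cont
  have hA := fourierHat_eq_fourierLaplace hab hd_supp
  refine ⟨fun x _ => finite_convPow_ne_zero ha hd_supp x, fun c hc => ⟨?_, fun hline => ?_⟩⟩
  · refine (hd.finite_fourierLaplace_eq_one (fourierLaplace_density_ne_one ha hd hd_nonneg hd_supp
      hd_int (k := Complex.I) (by simp)) (-c) 0).subset fun k hk => ⟨⟨hk.1.le, hk.2.1.le⟩, ?_⟩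
    rw [← hA]
    exact sub_eq_zero.1 hk.2.2
  · have hmain : ∀ x : ℝ, 0 < x →
        (convSeries d x : ℂ) = (d x : ℂ) + expansion a b d c x := fun x hx =>
      convSeries_eq_add_expansion ha hab hd_nonneg hd_supp hd_int hd_cont hc hline hx
    have hline' : ∀ k : ℂ, k.im = -c → fourierLaplace (fun x => (d x : ℂ)) k ≠ 1 := fun k hk => by
      rw [← hA]
      exact sub_ne_zero.1 (hline k hk)
    refine ⟨fun x hx hx' => ?_, hmain, ?_, fun x _ => ?_⟩
    · rw [hmain x hx, hd_supp x hx', Complex.ofReal_zero, zero_add]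
    · exact (hd.integrable_deriv_mul_div_one_sub hline').congr
        (.of_forall fun u => (lineFun_eq hA hline' u).symm)
    · rw [errorTerm, norm_mul]
      have h1 : ‖1 / (2 * (Real.pi : ℂ) * Complex.I)‖ = 1 / (2 * Real.pi) := by
        simp [abs_of_pos Real.pi_pos]
      rw [h1]
      gcongr
      refine (norm_integral_le_integral_norm _).trans_eq ?_
      congr with u
      rw [norm_mul, Complex.norm_exp]
      simp
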